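/- A variety of finite groups is a nonempty class $\mathscr C$ of finite groups closed under subgroups, finite direct products and homomorphic images; it is extension-closed if $G\in\mathscr C$ whenever $G$ has a normal subgroup $N$ with $N\in\mathscr C$ and $G/N\in\mathscr C$. A pro-$\mathscr C$ group is a profinite group all of whose quotients by open normal subgroups lie in $\mathscr C$. A free pro-$\mathscr C$ group on a pointed profinite space $(X,*)$ is a pro-$\mathscr C$ group $F$ with a continuous map $\iota\colon X\to F$, $\iota(*)=1$, such that for every pro-$\mathscr C$ group $G$ and every continuous $\sigma\colon X\to G$ with $\sigma(*)=1$ there is a unique continuous homomorphism $\psi\colon F\to G$ with $\psi\iota=\sigma$. **Theorem.** Let $\mathscr C$ be an extension-closed variety of finite groups, let $F$ (with $\iota\colon X\to F$) be a free pro-$\mathscr C$ group on a pointed profinite space $(X,*)$, and let $H$ be an open subgroup of $F$. Then $H$ is a free pro-$\mathscr C$ group on a pointed profinite space. More precisely, let $E$ be the abstract free group on $X\setminus\{*\}$ and $\varphi\colon E\to F$ the homomorphism extending $\iota$ (its image is the abstract subgroup of $F$ generated by $\iota(X)$). A Schreier transversal of a subgroup $K\le E$ is a set $T\subseteq E$ of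 representatives of the right cosets $Kg$ that contains, with each reduced word, all of its prefixes. Then $\varphi^{-1}(H)$ has a Schreier transversal in $E$, and for every such Schreier transversal $T$: 1. every right coset of $H$ in $F$ contains $\varphi(t)$ for exactly one $t\in T$; for $g\in F$ write $\overline g$ for the element of $\varphi(T)$ in $Hg$; 2. the set $$B=\{\varphi(t)\,\iota(x)\,\bigl(\overline{\varphi(t)\iota(x)}\bigr)^{-1} : t\in T,\ x\in X\}\subseteq H$$ is closed and contains $1$; 3. $H$, with the inclusion $B\hookrightarrow H$, is a free pro-$\mathscr C$ group on the pointed profinite space $(B,1)$. -/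

import Mathlib

universe u

/-- A variety of finite groups: a nonempty class of finite groups closed under subgroups,
finite direct products and homomorphic images (in particular under isomorphism). -/
structure IsVarietyOfFiniteGroups (𝒞 : ∀ (G : Type u) [Group G], Prop) : Prop where
  finite : ∀ (G : Type u) [Group G], 𝒞 G → Finite G
  nonempty : ∃ (G : Type u) (_ : Group G), 𝒞 G
  subgroup : ∀ (G : Type u) [Group G], 𝒞 G → ∀ K : Subgroup G, 𝒞 K
  pi : ∀ (I : Type u) [Finite I] (G : I → Type u) [∀ i, Group (G i)],
    (∀ i, 𝒞 (G i)) → 𝒞 (∀ i, G i)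
  image : ∀ (G K : Type u) [Group G] [Group K] (f : G →* K),
    Function.Surjective f → 𝒞 G → 𝒞 K

/-- A variety of finite groups that is closed under group extensions. -/
structure IsExtensionClosedVariety (𝒞 : ∀ (G : Type u) [Group G], Prop) : Prop
    extends IsVarietyOfFiniteGroups 𝒞 where
  extension : ∀ (G : Type u) [Group G] (N : Subgroup G) [N.Normal], 𝒞 N → 𝒞 (G ⧸ N) → 𝒞 G

/-- Profinite spaces: compact, Hausdorff and totally disconnected. -/
structure IsProfiniteSpace (X : Type u) [TopologicalSpace X] : Prop
    extends CompactSpace X, T2Space X, TotallyDisconnectedSpace X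

/-- A pro-`𝒞` group: a profinite group all of whose finite continuous quotients,
i.e. quotients by open normal subgroups, are in `𝒞`. -/
structure IsProC (𝒞 : ∀ (G : Type u) [Group G], Prop) (G : Type u) [Group G]
    [TopologicalSpace G] : Prop extends IsTopologicalGroup G, IsProfiniteSpace G where
  quotient_mem : ∀ (N : Subgroup G) [N.Normal], IsOpen (N : Set G) → 𝒞 (G ⧸ N)

/-- `F` is a free pro-`𝒞` group on the pointed profinite space `(X, pt)`, with structure map
`ι : X → F`: every continuous pointed map from `X` to a pro-`𝒞` group `G` (pointed by `1`)
factors uniquely through `ι` by a continuous homomorphism `F → G`. -/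
structure IsFreeProC (𝒞 : ∀ (G : Type u) [Group G], Prop) {X : Type u} [TopologicalSpace X]
    (pt : X) {F : Type u} [Group F] [TopologicalSpace F] (ι : X → F) : Prop where
  profinite_space : IsProfiniteSpace X
  isProC : IsProC 𝒞 F
  continuous_map : Continuous ι
  map_pt : ι pt = 1
  existsUnique_lift : ∀ (G : Type u) [Group G] [TopologicalSpace G], IsProC 𝒞 G →
    ∀ σ : X → G, Continuous σ → σ pt = 1 → ∃! ψ : F →ₜ* G, ∀ x, ψ (ι x) = σ x

/-- A Schreier transversal of a subgroup `K` of the free group on `α`: a set of representatives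
of the right cosets `K * g` which is closed under taking prefixes of reduced words. -/
structure IsSchreierTransversal {α : Type u} (K : Subgroup (FreeGroup α))
    (T : Set (FreeGroup α)) : Prop where
  transversal : Subgroup.IsComplement (K : Set (FreeGroup α)) T
  prefix_mem : ∀ L₁ L₂ : List (α × Bool), FreeGroup.IsReduced (L₁ ++ L₂) →
    FreeGroup.mk (L₁ ++ L₂) ∈ T → FreeGroup.mk L₁ ∈ T

/-- The canonical homomorphism from the abstract free group on `X \ {pt}` to `F`. Its image is
the abstract subgroup of `F` generated by `ι X` (as `ι pt = 1`). -/
def abstractFreeMap {X : Type u} (pt : X) {F : Type u} [Group F] (ι : X → F) :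
    FreeGroup {x : X // x ≠ pt} →* F :=
  FreeGroup.lift (fun x => ι x.1)

/-- The set of all `t * x * s⁻¹`, where `t` is in the transversal `T`, `x` is in `X`, and `s` is the
representative in `T` of the coset `H * t * x`. For `s` in `T`, this last condition on `s` says
exactly that `t * x * s⁻¹` lies in `H`, so it is expressed by the type of `b`. -/
def schreierSet {X : Type u} (pt : X) {F : Type u} [Group F] (ι : X → F) (H : Subgroup F)
    (T : Set (FreeGroup {x : X // x ≠ pt})) : Set H :=
  {b : H | ∃ t ∈ T, ∃ x : X, ∃ s ∈ T,
    (b : F) = abstractFreeMap pt ι t * ι x * (abstractFreeMap pt ι s)⁻¹}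

/-!
The proof realizes the extension of a map from the Schreier set `B` to a pro-`𝒞` group `G` by means
of a wreath product. Let `I` be the finite set of cosets of `H`, and let `Q` be the group of
permutations of `I` induced by `F`. As `𝒞` is extension-closed, the wreath product `G ≀ Q`, that is
the semidirect product of the functions `I → G` with `Q`, is again pro-`𝒞`
(`IsProC.semidirectProduct`). Homomorphisms from `F` to it lying over `F → Q` are the cocycles
`c : F → I → G`, so the universal property of `F` says that continuous cocycles can be prescribed
freely and uniquely on `X` (`IsFreeProC.existsUnique_cocycle`).

The transversal defines a cocycle with values in `H`, sending `f` and the coset of `t ∈ T` to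
`t f s⁻¹`, where `s ∈ T` represents the coset of `t f` (`IsCosetSection.cocycle`). Its values on `X`
are the elements of `B`. A continuous pointed map `σ : B → G` therefore prescribes a cocycle
with values in `G` on `X`; on `H`, evaluated at the trivial coset, the resulting cocycle is a
homomorphism. It extends `σ` because it is trivial on `T`, which is where the prefix property of a
Schreier transversal is used (`IsCosetSection.functionCocycle_eq_one`). Conversely a continuous
homomorphism `H → G` is recovered from its composition with the `H`-valued cocycle, and this
cocycle is determined by its values on `X`, hence by the restriction of the homomorphism to `B`
(`IsFreeProC.schreierSet_hom_ext`).

The transversal of the preimage of `H` in the abstract free group maps to a transversal of `H`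
because the subgroup generated by `X` is dense, and this too follows from the uniqueness part of
the universal property (`IsFreeProC.exists_mul_inv_mem`). Schreier transversals exist by Zorn's
lemma (`exists_isSchreierTransversal`).
-/

/-! ### Schreier transversals in free groups -/

/-- Appending a letter to a reduced word either gives a reduced word or cancels the last letter;
in the latter case the product is represented by a prefix of the original word. -/
theorem FreeGroup.isReduced_append_singleton_or {α : Type u} (L : List (α × Bool))
    (hL : FreeGroup.IsReduced L) (a : α × Bool) :
    FreeGroup.IsReduced (L ++ [a]) ∨
      ∃ M b, L = M ++ [b] ∧ FreeGroup.mk L * FreeGroup.mk [a] = FreeGroup.mk M := by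
  rcases List.eq_nil_or_concat' L with rfl | ⟨M, b, rfl⟩
  · left; simp
  · by_cases hab : b.1 = a.1 → b.2 = a.2
    · left
      refine List.isChain_append.2 ⟨hL, List.isChain_singleton a, ?_⟩
      intro x hx y hy
      simp only [List.getLast?_append, List.getLast?_singleton, Option.some_or, Option.mem_def,
        Option.some.injEq, List.head?_cons] at hx hy
      subst hx hy
      exact hab
    · right
      refine ⟨M, b, rfl, ?_⟩
      push Not at hab
      obtain ⟨b1, b2⟩ := b
      obtain ⟨a1, a2⟩ := a
      obtain ⟨h1, h2⟩ := hab
      simp only at h1 h2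
      subst h1
      have ha : a2 = !b2 := by cases a2 <;> cases b2 <;> simp_all
      subst ha
      rw [FreeGroup.mul_mk]
      apply FreeGroup.Red.exact.2
      refine ⟨M, ?_, Relation.ReflTransGen.refl⟩
      have := @FreeGroup.Red.Step.not _ M [] b1 b2
      exact Relation.ReflTransGen.single (by simpa using this)

/-- Two reduced words representing the same element of the free group coincide. -/
theorem FreeGroup.IsReduced.eq_of_mk_eq {α : Type u} {L₁ L₂ : List (α × Bool)}
    (h₁ : FreeGroup.IsReduced L₁) (h₂ : FreeGroup.IsReduced L₂)
    (h : FreeGroup.mk L₁ = FreeGroup.mk L₂) : L₁ = L₂ := by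
  classical
  rw [← h₁.reduce_eq, ← h₂.reduce_eq]
  exact FreeGroup.reduce.sound h

/-- A set of representatives of some of the right cosets of `K` that contains `1` and all prefixes
of its elements. -/
structure IsPartialSchreierTransversal {α : Type u} (K : Subgroup (FreeGroup α))
    (T : Set (FreeGroup α)) : Prop where
  one_mem : 1 ∈ T
  injOn : ∀ s ∈ T, ∀ t ∈ T, s * t⁻¹ ∈ K → s = t
  prefix_mem : ∀ L₁ L₂ : List (α × Bool), FreeGroup.IsReduced (L₁ ++ L₂) →
    FreeGroup.mk (L₁ ++ L₂) ∈ T → FreeGroup.mk L₁ ∈ T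

theorem isPartialSchreierTransversal_singleton_one {α : Type u} (K : Subgroup (FreeGroup α)) :
    IsPartialSchreierTransversal K {1} where
  one_mem := rfl
  injOn := by rintro s rfl t rfl _; rfl
  prefix_mem L₁ L₂ hL h := by
    have := FreeGroup.IsReduced.eq_of_mk_eq hL FreeGroup.IsReduced.nil h
    simp only [List.append_eq_nil_iff] at this
    rw [this.1]; rfl

theorem exists_maximal_isPartialSchreierTransversal {α : Type u} (K : Subgroup (FreeGroup α)) :
    ∃ T, Maximal (IsPartialSchreierTransversal K) T := by
  have hchains : ∀ c ⊆ {T | IsPartialSchreierTransversal K T}, IsChain (· ⊆ ·) c → c.Nonempty →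
      ∃ ub ∈ {T | IsPartialSchreierTransversal K T}, ∀ s ∈ c, s ⊆ ub := by
    intro c hc hchain ⟨T₀, hT₀⟩
    refine ⟨⋃₀ c, ⟨⟨T₀, hT₀, (hc hT₀).one_mem⟩, ?_, ?_⟩, fun s hs => Set.subset_sUnion_of_mem hs⟩
    · rintro s ⟨S, hS, hs⟩ t ⟨S', hS', ht⟩ hst
      rcases hchain.total hS hS' with h | h
      · exact (hc hS').injOn s (h hs) t ht hst
      · exact (hc hS).injOn s hs t (h ht) hst
    · rintro L₁ L₂ hL ⟨S, hS, hs⟩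
      exact ⟨S, hS, (hc hS).prefix_mem L₁ L₂ hL hs⟩
  obtain ⟨T, -, hT⟩ := zorn_subset_nonempty _ hchains {1}
    (isPartialSchreierTransversal_singleton_one K)
  exact ⟨T, hT⟩

/-- A partial Schreier transversal `T` can be enlarged by the product of an element of `T` and a
letter, provided this product lies in a coset not yet represented. -/
theorem IsPartialSchreierTransversal.insert {α : Type u} {K : Subgroup (FreeGroup α)}
    {T : Set (FreeGroup α)} (hT : IsPartialSchreierTransversal K T) {t : FreeGroup α} (ht : t ∈ T)
    (a : α × Bool) (hta : ∀ s ∈ T, t * FreeGroup.mk [a] * s⁻¹ ∉ K) :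
    IsPartialSchreierTransversal K (insert (t * FreeGroup.mk [a]) T) where
  one_mem := Or.inr hT.one_mem
  injOn := by
    rintro x (rfl | hx) y (rfl | hy) hxy
    · rfl
    · exact (hta y hy hxy).elim
    · refine (hta x hx ?_).elim
      have := K.inv_mem hxy
      rwa [mul_inv_rev, inv_inv] at this
    · exact hT.injOn x hx y hy hxy
  prefix_mem L₁ L₂ hL := by
    classical
    rintro (h | h)
    · have hred : FreeGroup.IsReduced (t.toWord ++ [a]) := by
        rcases FreeGroup.isReduced_append_singleton_or t.toWord FreeGroup.isReduced_toWord a with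
          h' | ⟨M, b, hM, hMa⟩
        · exact h'
        -- if the letter cancelled, the product would be a prefix of `t`, hence in `T`
        · rw [FreeGroup.mk_toWord] at hMa
          have hMT : FreeGroup.mk M ∈ T := hT.prefix_mem M [b]
            (hM ▸ FreeGroup.isReduced_toWord) (by rwa [← hM, FreeGroup.mk_toWord])
          refine (hta _ hMT ?_).elim
          rw [hMa, mul_inv_cancel]
          exact K.one_mem
      have heq : L₁ ++ L₂ = t.toWord ++ [a] := by
        refine hL.eq_of_mk_eq hred ?_
        rw [h, ← FreeGroup.mul_mk, FreeGroup.mk_toWord]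
      rcases List.eq_nil_or_concat' L₂ with rfl | ⟨M, b, rfl⟩
      · rw [List.append_nil] at h
        exact Or.inl h
      · right
        rw [← List.append_assoc] at heq
        have h₁ : L₁ ++ M = t.toWord := (List.append_inj' heq rfl).1
        exact hT.prefix_mem L₁ M (h₁ ▸ FreeGroup.isReduced_toWord)
          (by rwa [h₁, FreeGroup.mk_toWord])
    · exact Or.inr (hT.prefix_mem L₁ L₂ hL h)

/-- Every subgroup of a free group has a Schreier transversal: a maximal partial one meets every
coset, as otherwise it could be enlarged at the first letter of some word that leads to a coset
which is not represented. -/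
theorem exists_isSchreierTransversal {α : Type u} (K : Subgroup (FreeGroup α)) :
    ∃ T, IsSchreierTransversal K T := by
  obtain ⟨T, hT, hmax⟩ := exists_maximal_isPartialSchreierTransversal K
  have hex : ∀ L : List (α × Bool), ∃ t ∈ T, FreeGroup.mk L * t⁻¹ ∈ K := by
    intro L
    induction L using List.reverseRecOn with
    | nil => exact ⟨1, hT.one_mem, by simp [← FreeGroup.one_eq_mk, K.one_mem]⟩
    | append_singleton L a ih =>
      obtain ⟨t, ht, hLt⟩ := ih
      suffices ∃ s ∈ T, t * FreeGroup.mk [a] * s⁻¹ ∈ K by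
        obtain ⟨s, hs, hts⟩ := this
        refine ⟨s, hs, ?_⟩
        rw [← FreeGroup.mul_mk]
        have := K.mul_mem hLt hts
        rwa [mul_assoc, mul_assoc, inv_mul_cancel_left, ← mul_assoc] at this
      by_contra! hne
      have hmem := hmax (hT.insert ht a hne) (Set.subset_insert _ _) (Set.mem_insert _ _)
      exact hne _ hmem (by rw [mul_inv_cancel]; exact K.one_mem)
  refine ⟨T, ?_, hT.prefix_mem⟩
  rw [Subgroup.isComplement_iff_existsUnique_mul_inv_mem]
  rintro ⟨L⟩
  obtain ⟨t, ht, hLt⟩ := hex L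
  refine ⟨⟨t, ht⟩, hLt, ?_⟩
  rintro ⟨s, hs⟩ hLs
  refine Subtype.ext (hT.injOn s hs t ht ?_)
  have : ((FreeGroup.mk L * s⁻¹)⁻¹ * (FreeGroup.mk L * t⁻¹)) ∈ K :=
    K.mul_mem (K.inv_mem hLs) hLt
  rwa [mul_inv_rev, inv_inv, mul_assoc,
    inv_mul_cancel_left] at this

/-! ### Closure properties of varieties and of pro-`𝒞` groups -/

section

variable {𝒞 : ∀ (G : Type u) [Group G], Prop}

/-- If `f : G → K` is a homomorphism to a group in `𝒞` and the normal subgroup `N` contains its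
kernel, then `G ⧸ N` is a quotient of the range of `f`, hence lies in `𝒞`. -/
theorem IsVarietyOfFiniteGroups.quotient_mem_of_ker_le (h𝒞 : IsVarietyOfFiniteGroups 𝒞)
    {G K : Type u} [Group G] [Group K] (f : G →* K) (hK : 𝒞 K) (N : Subgroup G) [N.Normal]
    (hN : f.ker ≤ N) : 𝒞 (G ⧸ N) := by
  have h1 : 𝒞 (G ⧸ f.ker) := h𝒞.image _ _ (QuotientGroup.quotientKerEquivRange f).symm.toMonoidHom
    (QuotientGroup.quotientKerEquivRange f).symm.surjective (h𝒞.subgroup K hK f.range)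
  refine h𝒞.image _ _ (QuotientGroup.map f.ker N (MonoidHom.id G) hN) ?_ h1
  exact QuotientGroup.map_surjective_of_surjective _ _ _ (QuotientGroup.mk_surjective) _

/-- The image of a pro-`𝒞` group under a homomorphism with open kernel is in `𝒞`. -/
theorem IsProC.range_mem (h𝒞 : IsVarietyOfFiniteGroups 𝒞) {G K : Type u} [Group G]
    [TopologicalSpace G] [Group K] (hG : IsProC 𝒞 G) (f : G →* K) (hf : IsOpen (f.ker : Set G)) :
    𝒞 f.range :=
  h𝒞.image _ _ (QuotientGroup.quotientKerEquivRange f).toMonoidHom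
    (QuotientGroup.quotientKerEquivRange f).surjective (hG.quotient_mem f.ker hf)

theorem IsVarietyOfFiniteGroups.isProC_of_discreteTopology (h𝒞 : IsVarietyOfFiniteGroups 𝒞)
    {G : Type u} [Group G] [TopologicalSpace G] [DiscreteTopology G] (hG : 𝒞 G) :
    IsProC 𝒞 G := by
  have := h𝒞.finite G hG
  refine ⟨inferInstance, ⟨inferInstance, inferInstance, inferInstance⟩, fun N _ _ => ?_⟩
  exact h𝒞.image _ _ (QuotientGroup.mk' N) (QuotientGroup.mk'_surjective N) hG

theorem Subgroup.isOpen_normalCore {F : Type u} [Group F] [TopologicalSpace F]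
    [IsTopologicalGroup F] [CompactSpace F] {H : Subgroup F} (hH : IsOpen (H : Set F)) :
    IsOpen (H.normalCore : Set F) := by
  have : Finite (F ⧸ H) := Subgroup.quotient_finite_of_isOpen H hH
  have : H.FiniteIndex := Subgroup.finiteIndex_of_finite_quotient
  exact Subgroup.isOpen_of_isClosed_of_finiteIndex _
    (Subgroup.normalCore_isClosed _ (Subgroup.isClosed_of_isOpen _ hH))

/-- Open subgroups of pro-`𝒞` groups are pro-`𝒞`: an open normal subgroup of `H` contains the
open normal core that it has in the ambient group. -/
theorem IsProC.of_isOpen (h𝒞 : IsVarietyOfFiniteGroups 𝒞) {F : Type u} [Group F]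
    [TopologicalSpace F] (hF : IsProC 𝒞 F) (H : Subgroup F) (hH : IsOpen (H : Set F)) :
    IsProC 𝒞 H := by
  have := hF.toIsTopologicalGroup
  have := hF.toCompactSpace
  have := hF.toT2Space
  have := hF.toTotallyDisconnectedSpace
  have hcl : IsClosed (H : Set F) := H.isClosed_of_isOpen hH
  refine ⟨inferInstance, ⟨isCompact_iff_compactSpace.1 hcl.isCompact, inferInstance,
    inferInstance⟩, fun N _ hN => ?_⟩
  have hN' : IsOpen ((N.map H.subtype : Subgroup F) : Set F) := by
    rw [Subgroup.coe_map]
    exact hH.isOpenMap_subtype_val _ hN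
  refine h𝒞.quotient_mem_of_ker_le
    ((QuotientGroup.mk' (N.map H.subtype).normalCore).comp H.subtype)
    (hF.quotient_mem _ (Subgroup.isOpen_normalCore hN')) N ?_
  intro h hh
  have h1 : (h : F) ∈ (N.map H.subtype).normalCore := by
    simpa [MonoidHom.mem_ker, QuotientGroup.eq_one_iff] using hh
  obtain ⟨n, hn, hnh⟩ := Subgroup.normalCore_le _ h1
  rwa [← Subtype.ext hnh]

/-- Finite products of pro-`𝒞` groups are pro-`𝒞`. -/
theorem IsProC.pi (h𝒞 : IsVarietyOfFiniteGroups 𝒞) {I : Type u} [Finite I] {G : I → Type u}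
    [∀ i, Group (G i)] [∀ i, TopologicalSpace (G i)] (hG : ∀ i, IsProC 𝒞 (G i)) :
    IsProC 𝒞 (∀ i, G i) := by
  classical
  have := fun i => (hG i).toIsTopologicalGroup
  have := fun i => (hG i).toCompactSpace
  have := fun i => (hG i).toT2Space
  have := fun i => (hG i).toTotallyDisconnectedSpace
  refine ⟨inferInstance, ⟨inferInstance, inferInstance, inferInstance⟩, fun N _ hN => ?_⟩
  let U : ∀ i, Subgroup (G i) := fun i => N.comap (MonoidHom.mulSingle G i)
  have hU : ∀ i, IsOpen (U i : Set (G i)) := fun i => hN.preimage (continuous_mulSingle i)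
  refine h𝒞.quotient_mem_of_ker_le
    (MonoidHom.pi fun i => (QuotientGroup.mk' (U i)).comp (Pi.evalMonoidHom G i))
    (h𝒞.pi I (fun i => G i ⧸ U i) fun i => (hG i).quotient_mem (U i) (hU i)) N ?_
  intro g hg
  refine Subgroup.pi_mem_of_mulSingle_mem g fun i => ?_
  have hgi := congrFun (MonoidHom.mem_ker.1 hg) i
  exact (QuotientGroup.eq_one_iff (N := U i) (g i)).1 hgi

end

/-! ### Semidirect products of pro-`𝒞` groups with finite groups -/

section

variable {P Q : Type u} [Group P] [Group Q] {φ : Q →* MulAut P} [TopologicalSpace P]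
  [TopologicalSpace Q]

/-- The topology of a semidirect product is that of the product of the underlying spaces. -/
instance SemidirectProduct.instTopologicalSpace : TopologicalSpace (P ⋊[φ] Q) :=
  TopologicalSpace.induced SemidirectProduct.equivProd inferInstance

/-- A semidirect product as a topological space is the product of its factors. -/
def SemidirectProduct.homeomorphProd : (P ⋊[φ] Q) ≃ₜ P × Q :=
  SemidirectProduct.equivProd.toHomeomorphOfIsInducing ⟨rfl⟩

theorem SemidirectProduct.continuous_left : Continuous fun w : P ⋊[φ] Q => w.left :=
  continuous_fst.comp SemidirectProduct.homeomorphProd.continuous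

theorem SemidirectProduct.continuous_right : Continuous fun w : P ⋊[φ] Q => w.right :=
  continuous_snd.comp SemidirectProduct.homeomorphProd.continuous

theorem SemidirectProduct.continuous_mk {Z : Type*} [TopologicalSpace Z] {f : Z → P} {g : Z → Q}
    (hf : Continuous f) (hg : Continuous g) :
    Continuous fun z => (⟨f z, g z⟩ : P ⋊[φ] Q) :=
  SemidirectProduct.homeomorphProd.symm.continuous.comp (hf.prodMk hg)

theorem SemidirectProduct.isTopologicalGroup [IsTopologicalGroup P] [DiscreteTopology Q]
    (hφ : ∀ q, Continuous (φ q)) : IsTopologicalGroup (P ⋊[φ] Q) := by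
  have hact : Continuous fun x : Q × P => φ x.1 x.2 := continuous_prod_of_discrete_left.2 hφ
  refine { continuous_mul := ?_, continuous_inv := ?_ }
  · have hl := SemidirectProduct.continuous_left (φ := φ)
    have hr := SemidirectProduct.continuous_right (φ := φ)
    exact SemidirectProduct.continuous_mk
      ((hl.comp continuous_fst).mul
        (hact.comp ((hr.comp continuous_fst).prodMk (hl.comp continuous_snd))))
      ((continuous_of_discreteTopology (f := fun x : Q × Q => x.1 * x.2)).comp
        ((hr.comp continuous_fst).prodMk (hr.comp continuous_snd)))
  · have hl := SemidirectProduct.continuous_left (φ := φ)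
    have hr := SemidirectProduct.continuous_right (φ := φ)
    have hi : Continuous fun w : P ⋊[φ] Q => w.right⁻¹ :=
      (continuous_of_discreteTopology (f := fun x : Q => x⁻¹)).comp hr
    exact SemidirectProduct.continuous_mk (hact.comp (hi.prodMk hl.inv)) hi

variable {𝒞 : ∀ (G : Type u) [Group G], Prop}

/-- The semidirect product of a pro-`𝒞` group with a finite group in `𝒞` is pro-`𝒞`. This is where
extension-closedness is needed: a finite quotient of `P ⋊ Q` is an extension of a quotient of `Q`
by a quotient of `P`. -/
theorem IsProC.semidirectProduct (h𝒞 : IsExtensionClosedVariety 𝒞) [DiscreteTopology Q]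
    (hP : IsProC 𝒞 P) (hQ : 𝒞 Q) (hφ : ∀ q, Continuous (φ q)) : IsProC 𝒞 (P ⋊[φ] Q) := by
  have h𝒞' := h𝒞.toIsVarietyOfFiniteGroups
  have := hP.toIsTopologicalGroup
  have := hP.toCompactSpace
  have := hP.toT2Space
  have := hP.toTotallyDisconnectedSpace
  have := h𝒞'.finite Q hQ
  let e := SemidirectProduct.homeomorphProd (φ := φ)
  refine ⟨SemidirectProduct.isTopologicalGroup hφ, ⟨e.symm.compactSpace, e.symm.t2Space, ?_⟩,
    fun N _ hN => ?_⟩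
  · exact ⟨e.isEmbedding.isTotallyDisconnected
      (isTotallyDisconnected_of_totallyDisconnectedSpace _)⟩
  let f : P →* (P ⋊[φ] Q) ⧸ N := (QuotientGroup.mk' N).comp SemidirectProduct.inl
  have hf : f.range = (SemidirectProduct.rightHom (φ := φ)).ker.map (QuotientGroup.mk' N) := by
    rw [MonoidHom.range_comp, SemidirectProduct.range_inl_eq_ker_rightHom]
  have : f.range.Normal := hf ▸ Subgroup.Normal.map inferInstance _ (QuotientGroup.mk'_surjective N)
  refine h𝒞.extension _ f.range (hP.range_mem h𝒞' f ?_) ?_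
  · have hker : (f.ker : Set P) = SemidirectProduct.inl ⁻¹' (N : Set (P ⋊[φ] Q)) := by
      ext p
      simp [f, MonoidHom.mem_ker]
    rw [hker]
    exact hN.preimage (SemidirectProduct.continuous_mk continuous_id continuous_const)
  · refine h𝒞'.image Q _ ((QuotientGroup.mk' f.range).comp
      ((QuotientGroup.mk' N).comp SemidirectProduct.inr)) ?_ hQ
    intro x
    obtain ⟨y, rfl⟩ := QuotientGroup.mk'_surjective _ x
    obtain ⟨w, rfl⟩ := QuotientGroup.mk'_surjective _ y
    refine ⟨w.right, ?_⟩
    conv_rhs => rw [← SemidirectProduct.inl_left_mul_inr_right w]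
    rw [map_mul, map_mul]
    have : QuotientGroup.mk' f.range (QuotientGroup.mk' N (SemidirectProduct.inl w.left)) = 1 :=
      (QuotientGroup.eq_one_iff _).2 ⟨w.left, rfl⟩
    rw [this, one_mul]
    rfl

end

/-! ### Homomorphisms and cocycles on free pro-`𝒞` groups -/

section

variable {𝒞 : ∀ (G : Type u) [Group G], Prop} {X : Type u} [TopologicalSpace X] {pt : X}
  {F : Type u} [Group F] [TopologicalSpace F] {ι : X → F}

theorem IsFreeProC.hom_ext (hF : IsFreeProC 𝒞 pt ι) {G : Type u} [Group G] [TopologicalSpace G]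
    (hG : IsProC 𝒞 G) {ψ₁ ψ₂ : F →ₜ* G} (h : ∀ x, ψ₁ (ι x) = ψ₂ (ι x)) : ψ₁ = ψ₂ :=
  (hF.existsUnique_lift G hG (fun x => ψ₂ (ι x)) (ψ₂.continuous_toFun.comp hF.continuous_map)
    (by rw [hF.map_pt, map_one])).unique h fun _ => rfl

theorem IsFreeProC.mem_range_abstractFreeMap (hF : IsFreeProC 𝒞 pt ι) (x : X) :
    ι x ∈ (abstractFreeMap pt ι).range := by
  by_cases hx : x = pt
  · rw [hx, hF.map_pt]
    exact one_mem _
  · exact ⟨FreeGroup.of ⟨x, hx⟩, FreeGroup.lift_apply_of⟩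

/-- The abstract subgroup generated by the image of `X` meets every coset of an open normal
subgroup `N`: the subgroup of `F ⧸ N` that it generates is in `𝒞`, so the quotient map factors
through this subgroup by the universal property. -/
theorem IsFreeProC.exists_mul_inv_mem (h𝒞 : IsVarietyOfFiniteGroups 𝒞) (hF : IsFreeProC 𝒞 pt ι)
    (N : Subgroup F) [N.Normal] (hN : IsOpen (N : Set F)) (g : F) :
    ∃ e, g * (abstractFreeMap pt ι e)⁻¹ ∈ N := by
  have := hF.isProC.toIsTopologicalGroup
  have : DiscreteTopology (F ⧸ N) := QuotientGroup.discreteTopology hN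
  have hQ : 𝒞 (F ⧸ N) := hF.isProC.quotient_mem N hN
  let D : Subgroup (F ⧸ N) := (abstractFreeMap pt ι).range.map (QuotientGroup.mk' N)
  have hD : IsProC 𝒞 D := h𝒞.isProC_of_discreteTopology (h𝒞.subgroup _ hQ D)
  let π : F →ₜ* F ⧸ N := ⟨QuotientGroup.mk' N, QuotientGroup.continuous_mk⟩
  obtain ⟨ψ, hψ, -⟩ := hF.existsUnique_lift D hD
    (fun x => ⟨π (ι x), ι x, hF.mem_range_abstractFreeMap x, rfl⟩)
    ((π.continuous_toFun.comp hF.continuous_map).subtype_mk _)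
    (Subtype.ext ((congrArg π hF.map_pt).trans (map_one π)))
  let j : D →ₜ* F ⧸ N := ⟨D.subtype, continuous_subtype_val⟩
  have hjψ : j.comp ψ = π :=
    hF.hom_ext (h𝒞.isProC_of_discreteTopology hQ) fun x => congrArg Subtype.val (hψ x)
  obtain ⟨-, ⟨e, rfl⟩, he⟩ : π g ∈ D := hjψ ▸ (ψ g).2
  refine ⟨e, ?_⟩
  rw [← QuotientGroup.eq_one_iff, QuotientGroup.mk_mul, QuotientGroup.mk_inv, mul_inv_eq_one]
  exact he.symm

/-- The action of `Q` on the functions on a `Q`-set `I` by automorphisms,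
`(q • b) w = b (q⁻¹ • w)`. -/
def functionMulAut (Q I G : Type*) [Group Q] [MulAction Q I] [Group G] : Q →* MulAut (I → G) :=
  letI := arrowMulDistribMulAction (G := Q) (A := I) (M := G)
  MulDistribMulAction.toMulAut Q (I → G)

/-- A 1-cocycle on `F` with values in the group of functions from the `F`-set `I` to `G`, on which
`F` acts by translation. -/
def IsFunctionCocycle {F I G : Type*} [Group F] [MulAction F I] [Group G] (c : F → I → G) : Prop :=
  ∀ f g w, c (f * g) w = c f w * c g (f⁻¹ • w)

theorem IsFunctionCocycle.map_one {F I G : Type*} [Group F] [MulAction F I] [Group G]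
    {c : F → I → G} (hc : IsFunctionCocycle c) (w : I) : c 1 w = 1 := by
  have h := hc 1 1 w
  rw [mul_one, inv_one, one_smul] at h
  exact left_eq_mul.1 h

theorem IsFunctionCocycle.map_inv {F I G : Type*} [Group F] [MulAction F I] [Group G]
    {c : F → I → G} (hc : IsFunctionCocycle c) (f : F) (w : I) : c f⁻¹ w = (c f (f • w))⁻¹ := by
  have h := hc f⁻¹ f w
  rw [inv_mul_cancel, hc.map_one, inv_inv] at h
  exact eq_inv_of_mul_eq_one_left h.symm

/-- Continuous cocycles on a free pro-`𝒞` group are prescribed freely on the basis. A cocycle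
`c : F → I → G` is the same as a homomorphism from `F` to the permutational wreath product of `G`
with the finite group `Q` of permutations of `I` induced by `F`, lying over `F → Q`. The wreath
product is pro-`𝒞`, so the universal property applies to it. -/
theorem IsFreeProC.existsUnique_cocycle (h𝒞 : IsExtensionClosedVariety 𝒞)
    (hF : IsFreeProC 𝒞 pt ι) {I : Type u} [Finite I] [MulAction F I]
    (hI : IsOpen ((MulAction.toPermHom F I).ker : Set F)) {G : Type u} [Group G]
    [TopologicalSpace G] (hG : IsProC 𝒞 G) (σ : X → I → G) (hσ : Continuous σ) (hσ1 : σ pt = 1) :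
    ∃! c : F → I → G, (Continuous c ∧ IsFunctionCocycle c) ∧ ∀ x, c (ι x) = σ x := by
  have h𝒞' := h𝒞.toIsVarietyOfFiniteGroups
  have := hF.isProC.toIsTopologicalGroup
  let Q := (MulAction.toPermHom F I).range
  let : TopologicalSpace Q := ⊥
  have : DiscreteTopology Q := ⟨rfl⟩
  have hQ : 𝒞 Q := hF.isProC.range_mem h𝒞' _ hI
  have hcont : Continuous (MulAction.toPermHom F I).rangeRestrict := by
    refine continuous_of_continuousAt_one _ ?_
    rw [ContinuousAt, _root_.map_one, nhds_discrete Q, Filter.tendsto_pure]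
    filter_upwards [hI.mem_nhds (one_mem (MulAction.toPermHom F I).ker)] with f hf
    exact Subtype.ext hf
  let π : F →ₜ* Q := ⟨(MulAction.toPermHom F I).rangeRestrict, hcont⟩
  let φ := functionMulAut Q I G
  have hφ : ∀ q, Continuous (φ q) := fun q => continuous_pi fun w => continuous_apply (q⁻¹ • w)
  have hW : IsProC 𝒞 ((I → G) ⋊[φ] Q) := (IsProC.pi h𝒞' fun _ => hG).semidirectProduct h𝒞 hQ hφ
  obtain ⟨Φ, hΦ, hΦu⟩ := hF.existsUnique_lift _ hW (fun x => ⟨σ x, π (ι x)⟩)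
    (SemidirectProduct.continuous_mk hσ (π.continuous_toFun.comp hF.continuous_map))
    (by rw [hσ1, hF.map_pt, _root_.map_one]; rfl)
  have hΦπ : ∀ f, (Φ f).right = π f := by
    let ρ : (I → G) ⋊[φ] Q →ₜ* Q :=
      ⟨SemidirectProduct.rightHom, SemidirectProduct.continuous_right⟩
    have : ρ.comp Φ = π := hF.hom_ext (h𝒞'.isProC_of_discreteTopology hQ) fun x =>
      congrArg SemidirectProduct.right (hΦ x)
    exact fun f => DFunLike.congr_fun this f
  refine ⟨fun f => (Φ f).left, ⟨⟨SemidirectProduct.continuous_left.comp Φ.continuous_toFun, ?_⟩,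
    fun x => congrArg SemidirectProduct.left (hΦ x)⟩, ?_⟩
  · intro f g w
    simp only [map_mul, SemidirectProduct.mul_left, Pi.mul_apply, hΦπ]
    rfl
  · rintro c ⟨⟨hc, hcc⟩, hcσ⟩
    let Ψ : F →ₜ* (I → G) ⋊[φ] Q :=
      ⟨MonoidHom.mk' (fun f => ⟨c f, π f⟩) fun f g =>
        SemidirectProduct.ext (funext fun w => hcc f g w) (map_mul π f g),
        SemidirectProduct.continuous_mk hc π.continuous_toFun⟩
    have hΨ : Ψ = Φ := hΦu Ψ fun x => SemidirectProduct.ext (hcσ x) rfl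
    funext f
    exact congrArg SemidirectProduct.left (DFunLike.congr_fun hΨ f)

end

/-! ### The Schreier basis of an open subgroup -/

section

variable {X : Type u} {pt : X} {F : Type u} [Group F] {ι : X → F} {H : Subgroup F}
  {T : Set (FreeGroup {x : X // x ≠ pt})}

theorem IsSchreierTransversal.one_mem {α : Type u} {K : Subgroup (FreeGroup α)}
    {T : Set (FreeGroup α)} (hT : IsSchreierTransversal K T) : 1 ∈ T := by
  classical
  obtain ⟨t, -⟩ := (Subgroup.isComplement_iff_existsUnique_mul_inv_mem.1 hT.transversal 1).exists
  exact hT.prefix_mem [] t.1.toWord (by simpa using FreeGroup.isReduced_toWord)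
    (by rw [List.nil_append, FreeGroup.mk_toWord]; exact t.2)

/-- The function `τ` assigns to each left coset of `H` the element of the transversal `T` whose
inverse represents it. Left cosets are used as `F` acts on them from the left; inversion turns
them into the right cosets represented by `T`. -/
structure IsCosetSection (ι : X → F) (H : Subgroup F) (T : Set (FreeGroup {x : X // x ≠ pt}))
    (τ : F ⧸ H → FreeGroup {x : X // x ≠ pt}) : Prop where
  mem : ∀ w, τ w ∈ T
  mk_inv : ∀ w, (((abstractFreeMap pt ι (τ w))⁻¹ : F) : F ⧸ H) = w
  apply_mk_inv : ∀ t ∈ T, τ (((abstractFreeMap pt ι t)⁻¹ : F) : F ⧸ H) = t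

theorem exists_isCosetSection
    (hT : ∀ g : F, ∃! t, t ∈ T ∧ g * (abstractFreeMap pt ι t)⁻¹ ∈ H) :
    ∃ τ, IsCosetSection ι H T τ := by
  have h : ∀ w : F ⧸ H, ∃ t ∈ T, (((abstractFreeMap pt ι t)⁻¹ : F) : F ⧸ H) = w := by
    intro w
    obtain ⟨g, rfl⟩ := QuotientGroup.mk_surjective w
    obtain ⟨t, ht, hgt⟩ := (hT g⁻¹).exists
    exact ⟨t, ht, (QuotientGroup.eq.2 hgt).symm⟩
  choose τ hτ hτw using h
  refine ⟨τ, hτ, hτw, fun t ht => ?_⟩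
  refine (hT (abstractFreeMap pt ι t)).unique ⟨hτ _, ?_⟩
    ⟨ht, by rw [mul_inv_cancel]; exact H.one_mem⟩
  have := QuotientGroup.eq.1 (hτw (((abstractFreeMap pt ι t)⁻¹ : F) : F ⧸ H)).symm
  rwa [inv_inv] at this

namespace IsCosetSection

variable {τ : F ⧸ H → FreeGroup {x : X // x ≠ pt}}

theorem mul_mul_inv_mem (hτ : IsCosetSection ι H T τ) (f : F) (w : F ⧸ H) :
    abstractFreeMap pt ι (τ w) * f * (abstractFreeMap pt ι (τ (f⁻¹ • w)))⁻¹ ∈ H := by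
  have h : ((f⁻¹ * (abstractFreeMap pt ι (τ w))⁻¹ : F) : F ⧸ H) =
      ((abstractFreeMap pt ι (τ (f⁻¹ • w)))⁻¹ : F) := by
    rw [hτ.mk_inv, ← smul_eq_mul, ← MulAction.Quotient.smul_coe, hτ.mk_inv]
  have := QuotientGroup.eq.1 h
  rwa [mul_inv_rev, inv_inv, inv_inv] at this

/-- The element `t f s⁻¹` of `H`, where `t ∈ T` corresponds to the coset `w` and `s ∈ T` is the
representative of the right coset of `t f`. -/
def cocycle (hτ : IsCosetSection ι H T τ) (f : F) (w : F ⧸ H) : H :=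
  ⟨_, hτ.mul_mul_inv_mem f w⟩

theorem coe_cocycle (hτ : IsCosetSection ι H T τ) (f : F) (w : F ⧸ H) :
    (hτ.cocycle f w : F) =
      abstractFreeMap pt ι (τ w) * f * (abstractFreeMap pt ι (τ (f⁻¹ • w)))⁻¹ :=
  rfl

theorem isFunctionCocycle_cocycle (hτ : IsCosetSection ι H T τ) :
    IsFunctionCocycle hτ.cocycle := by
  intro f g w
  refine Subtype.ext ?_
  rw [Subgroup.coe_mul, coe_cocycle, coe_cocycle, coe_cocycle, mul_inv_rev, mul_smul]
  group

theorem cocycle_mem_schreierSet (hτ : IsCosetSection ι H T τ) (x : X) (w : F ⧸ H) :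
    hτ.cocycle (ι x) w ∈ schreierSet pt ι H T :=
  ⟨τ w, hτ.mem w, x, τ ((ι x)⁻¹ • w), hτ.mem _, rfl⟩

/-- The value `b = t f s⁻¹` is recognized by its lying in `H`, which forces `s` to be the
representative of the right coset of `t f`. -/
theorem cocycle_apply_mk_inv (hτ : IsCosetSection ι H T τ) {s t : FreeGroup {x : X // x ≠ pt}}
    (ht : t ∈ T) (hs : s ∈ T) (f : F) (b : H)
    (hb : (b : F) = abstractFreeMap pt ι t * f * (abstractFreeMap pt ι s)⁻¹) :
    hτ.cocycle f (((abstractFreeMap pt ι t)⁻¹ : F) : F ⧸ H) = b := by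
  refine Subtype.ext ?_
  have h : f⁻¹ • (((abstractFreeMap pt ι t)⁻¹ : F) : F ⧸ H) =
      ((abstractFreeMap pt ι s)⁻¹ : F) := by
    rw [MulAction.Quotient.smul_coe, smul_eq_mul, QuotientGroup.eq, mul_inv_rev, inv_inv, inv_inv,
      ← hb]
    exact b.2
  rw [coe_cocycle, h, hτ.apply_mk_inv t ht, hτ.apply_mk_inv s hs, hb]

theorem continuous_cocycle [TopologicalSpace F] [IsTopologicalGroup F] (hτ : IsCosetSection ι H T τ)
    (hH : IsOpen (H : Set F)) : Continuous hτ.cocycle := by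
  have : DiscreteTopology (F ⧸ H) := QuotientGroup.discreteTopology hH
  refine continuous_pi fun w => Continuous.subtype_mk ?_ _
  have hw : Continuous fun f : F => f⁻¹ • w := by fun_prop
  exact (continuous_const.mul continuous_id).mul
    ((continuous_of_discreteTopology
      (f := fun v : F ⧸ H => (abstractFreeMap pt ι (τ v))⁻¹)).comp hw)

/-- Suppose that a cocycle has value `1` at `x` on the coset of `t ∈ T` whenever `t x` is the image
of an element of `T`. Then it has value `1` at each element of `T` on the trivial coset: along a
reduced word in `T` its value is a product of values of this kind and of their inverses, since all
prefixes belong to `T`. -/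
theorem functionCocycle_eq_one {G : Type*} [Group G]
    (hT : IsSchreierTransversal (H.comap (abstractFreeMap pt ι)) T) {c : F → F ⧸ H → G}
    (hc : IsFunctionCocycle c)
    (h : ∀ t ∈ T, ∀ s ∈ T, ∀ x, abstractFreeMap pt ι t * ι x = abstractFreeMap pt ι s →
      c (ι x) (((abstractFreeMap pt ι t)⁻¹ : F) : F ⧸ H) = 1)
    {t : FreeGroup {x : X // x ≠ pt}} (ht : t ∈ T) :
    c (abstractFreeMap pt ι t) ((1 : F) : F ⧸ H) = 1 := by
  classical
  suffices ∀ L : List ({x : X // x ≠ pt} × Bool), FreeGroup.IsReduced L → FreeGroup.mk L ∈ T →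
      c (abstractFreeMap pt ι (FreeGroup.mk L)) ((1 : F) : F ⧸ H) = 1 by
    have := this t.toWord FreeGroup.isReduced_toWord
    rw [FreeGroup.mk_toWord] at this
    exact this ht
  intro L hL hLT
  induction L using List.reverseRecOn with
  | nil => rw [← FreeGroup.one_eq_mk, map_one, hc.map_one]
  | append_singleton L a ih =>
    have hpT : FreeGroup.mk L ∈ T := hT.prefix_mem L [a] hL hLT
    rw [← FreeGroup.mul_mk] at hLT ⊢
    rw [map_mul, hc, ih (hL.infix ⟨[], [a], by simp⟩) hpT, one_mul,
      MulAction.Quotient.smul_coe, smul_eq_mul, mul_one]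
    obtain ⟨x, b⟩ := a
    have hx : abstractFreeMap pt ι (FreeGroup.mk [(x, true)]) = ι x := FreeGroup.lift_apply_of
    cases b with
    | true =>
      rw [hx]
      exact h _ hpT _ hLT x (by rw [map_mul, hx])
    | false =>
      have hx' : abstractFreeMap pt ι (FreeGroup.mk [(x, false)]) = (ι x)⁻¹ := by
        rw [← hx, ← map_inv, FreeGroup.inv_mk]
        rfl
      have hpx := map_mul (abstractFreeMap pt ι) (FreeGroup.mk L) (FreeGroup.mk [(x, false)])
      rw [hx'] at hpx
      have := h _ hLT _ hpT x (by rw [hpx, inv_mul_cancel_right])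
      rw [hpx, mul_inv_rev, inv_inv] at this
      rw [hx', hc.map_inv, MulAction.Quotient.smul_coe, smul_eq_mul, this, inv_one]

end IsCosetSection

theorem one_mem_schreierSet (hT : (1 : FreeGroup {x : X // x ≠ pt}) ∈ T) (hpt : ι pt = 1) :
    (1 : H) ∈ schreierSet pt ι H T :=
  ⟨1, hT, pt, 1, hT, by simp [hpt]⟩

variable [TopologicalSpace X] [TopologicalSpace F] {𝒞 : ∀ (G : Type u) [Group G], Prop}

theorem isClosed_schreierSet [CompactSpace X] [T2Space F] [IsTopologicalGroup F]
    (hι : Continuous ι) (hT : T.Finite) : IsClosed (schreierSet pt ι H T) := by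
  have : schreierSet pt ι H T = ⋃ t ∈ T, ⋃ s ∈ T, ((↑) : H → F) ⁻¹'
      Set.range fun x => abstractFreeMap pt ι t * ι x * (abstractFreeMap pt ι s)⁻¹ := by
    ext b
    simp only [schreierSet, Set.mem_ofPred_eq, Set.mem_iUnion, Set.mem_preimage, Set.mem_range,
      exists_prop]
    refine exists_congr fun t => and_congr_right fun _ => ⟨?_, ?_⟩
    · rintro ⟨x, s, hs, hb⟩
      exact ⟨s, hs, x, hb.symm⟩
    · rintro ⟨s, hs, x, hb⟩
      exact ⟨x, s, hs, hb.symm⟩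
  rw [this]
  refine hT.isClosed_biUnion fun t _ => hT.isClosed_biUnion fun s _ => ?_
  exact (isCompact_range ((continuous_const.mul hι).mul continuous_const)).isClosed.preimage
    continuous_subtype_val

/-- A transversal of the preimage of `H` in the abstract free group maps to a transversal of `H`. -/
theorem IsFreeProC.existsUnique_mem_transversal (h𝒞 : IsVarietyOfFiniteGroups 𝒞)
    (hF : IsFreeProC 𝒞 pt ι) (hH : IsOpen (H : Set F))
    (hT : IsSchreierTransversal (H.comap (abstractFreeMap pt ι)) T) (g : F) :
    ∃! t, t ∈ T ∧ g * (abstractFreeMap pt ι t)⁻¹ ∈ H := by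
  have := hF.isProC.toIsTopologicalGroup
  have := hF.isProC.toCompactSpace
  obtain ⟨e, he⟩ := hF.exists_mul_inv_mem h𝒞 H.normalCore (Subgroup.isOpen_normalCore hH) g
  have hgt : ∀ t, g * (abstractFreeMap pt ι t)⁻¹ ∈ H ↔
      e * t⁻¹ ∈ H.comap (abstractFreeMap pt ι) := by
    intro t
    have h := H.mul_mem_cancel_left (y := abstractFreeMap pt ι e * (abstractFreeMap pt ι t)⁻¹)
      (H.normalCore_le he)
    rw [Subgroup.mem_comap, map_mul, map_inv]
    rwa [mul_assoc, inv_mul_cancel_left] at h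
  obtain ⟨t, ht, hu⟩ := Subgroup.isComplement_iff_existsUnique_mul_inv_mem.1 hT.transversal e
  exact ⟨t, ⟨t.2, (hgt t).2 ht⟩, fun s hs =>
    congrArg Subtype.val (hu ⟨s, hs.1⟩ ((hgt s).1 hs.2))⟩

/-- Existence of the extension of a pointed map `σ` on the Schreier set. The values of `σ` on
the elements `t x s⁻¹` prescribe a cocycle on the generators of `F`, and the extension is the
resulting cocycle on `H` evaluated at the trivial coset, which `H` fixes. -/
theorem IsFreeProC.exists_schreierSet_lift (h𝒞 : IsExtensionClosedVariety 𝒞)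
    (hF : IsFreeProC 𝒞 pt ι) (hH : IsOpen (H : Set F))
    (hT : IsSchreierTransversal (H.comap (abstractFreeMap pt ι)) T)
    (h₁ : (1 : H) ∈ schreierSet pt ι H T) {G : Type u} [Group G] [TopologicalSpace G]
    (hG : IsProC 𝒞 G) (σ : schreierSet pt ι H T → G) (hσ : Continuous σ) (hσ1 : σ ⟨1, h₁⟩ = 1) :
    ∃ ψ : H →ₜ* G, ∀ b : schreierSet pt ι H T, ψ b = σ b := by
  have := hF.isProC.toIsTopologicalGroup
  have := hF.isProC.toCompactSpace
  have : Finite (F ⧸ H) := Subgroup.quotient_finite_of_isOpen H hH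
  obtain ⟨τ, hτ⟩ := exists_isCosetSection
    (hF.existsUnique_mem_transversal h𝒞.toIsVarietyOfFiniteGroups hH hT)
  have hker : IsOpen ((MulAction.toPermHom F (F ⧸ H)).ker : Set F) := by
    rw [← Subgroup.normalCore_eq_ker]
    exact Subgroup.isOpen_normalCore hH
  obtain ⟨c, ⟨⟨hc, hcc⟩, hcι⟩, -⟩ := hF.existsUnique_cocycle h𝒞 hker hG
    (fun x w => σ ⟨hτ.cocycle (ι x) w, hτ.cocycle_mem_schreierSet x w⟩)
    (continuous_pi fun w => hσ.comp (Continuous.subtype_mk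
      ((continuous_apply w).comp ((hτ.continuous_cocycle hH).comp hF.continuous_map)) _))
    (funext fun w => by
      refine (congrArg σ (Subtype.ext ?_)).trans hσ1
      change hτ.cocycle (ι pt) w = 1
      rw [hF.map_pt, hτ.isFunctionCocycle_cocycle.map_one])
  have hkey : ∀ t ∈ T, ∀ s ∈ T, ∀ x, ∀ b : schreierSet pt ι H T,
      ((b : H) : F) = abstractFreeMap pt ι t * ι x * (abstractFreeMap pt ι s)⁻¹ →
      c (ι x) (((abstractFreeMap pt ι t)⁻¹ : F) : F ⧸ H) = σ b := by
    intro t ht s hs x b hb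
    rw [hcι]
    exact congrArg σ (Subtype.ext (hτ.cocycle_apply_mk_inv ht hs (ι x) b hb))
  have hcT : ∀ t ∈ T, c (abstractFreeMap pt ι t) ((1 : F) : F ⧸ H) = 1 := fun t ht =>
    IsCosetSection.functionCocycle_eq_one hT hcc (fun t ht s hs x htx => by
      rw [hkey t ht s hs x ⟨1, h₁⟩ (by rw [htx, mul_inv_cancel]; rfl), hσ1]) ht
  have hfix : ∀ h : H, (h : F)⁻¹ • ((1 : F) : F ⧸ H) = ((1 : F) : F ⧸ H) := by
    intro h
    rw [MulAction.Quotient.smul_coe, smul_eq_mul, QuotientGroup.eq]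
    simp
  refine ⟨⟨MonoidHom.mk' (fun h : H => c h ((1 : F) : F ⧸ H)) fun h k => ?_,
    (continuous_apply ((1 : F) : F ⧸ H)).comp (hc.comp continuous_subtype_val)⟩, ?_⟩
  · rw [Subgroup.coe_mul, hcc, hfix]
  · intro b
    change c ((b : H) : F) ((1 : F) : F ⧸ H) = σ b
    obtain ⟨t, ht, x, s, hs, hb⟩ := b.2
    -- the cocycle at `s⁻¹` is evaluated at the left coset of `(t x)⁻¹`, which `s` moves to the
    -- trivial coset, so it is the inverse of the value at `s` on the trivial coset
    have hs1 : abstractFreeMap pt ι s •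
        (abstractFreeMap pt ι t * ι x)⁻¹ • ((1 : F) : F ⧸ H) = ((1 : F) : F ⧸ H) := by
      have := hfix b
      rwa [hb, mul_inv_rev, inv_inv, mul_smul] at this
    rw [hb, hcc, hcc, hcT t ht, one_mul, hcc.map_inv, hs1, hcT s hs, inv_one, mul_one,
      MulAction.Quotient.smul_coe, smul_eq_mul, mul_one]
    exact hkey t ht s hs x b hb

/-- Uniqueness of extensions from the Schreier set. Composition with `cocycle` embeds the continuous
homomorphisms `H → G` into the continuous cocycles on `F`, and these are determined by their
values on the generators of `F`. -/
theorem IsFreeProC.schreierSet_hom_ext (h𝒞 : IsExtensionClosedVariety 𝒞)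
    (hF : IsFreeProC 𝒞 pt ι) (hH : IsOpen (H : Set F))
    (hT : IsSchreierTransversal (H.comap (abstractFreeMap pt ι)) T) {G : Type u} [Group G]
    [TopologicalSpace G] (hG : IsProC 𝒞 G) {ψ₁ ψ₂ : H →ₜ* G}
    (hψ : ∀ b : schreierSet pt ι H T, ψ₁ b = ψ₂ b) : ψ₁ = ψ₂ := by
  have := hF.isProC.toIsTopologicalGroup
  have := hF.isProC.toCompactSpace
  have : Finite (F ⧸ H) := Subgroup.quotient_finite_of_isOpen H hH
  obtain ⟨τ, hτ⟩ := exists_isCosetSection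
    (hF.existsUnique_mem_transversal h𝒞.toIsVarietyOfFiniteGroups hH hT)
  have hker : IsOpen ((MulAction.toPermHom F (F ⧸ H)).ker : Set F) := by
    rw [← Subgroup.normalCore_eq_ker]
    exact Subgroup.isOpen_normalCore hH
  have hcont : ∀ ψ : H →ₜ* G, Continuous fun f w => ψ (hτ.cocycle f w) := fun ψ =>
    continuous_pi fun w => ψ.continuous_toFun.comp
      ((continuous_apply w).comp (hτ.continuous_cocycle hH))
  have hcoc : ∀ ψ : H →ₜ* G, IsFunctionCocycle fun f w => ψ (hτ.cocycle f w) := fun ψ f g w =>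
    (congrArg ψ (hτ.isFunctionCocycle_cocycle f g w)).trans (map_mul ψ _ _)
  have heq := (hF.existsUnique_cocycle h𝒞 hker hG (fun x w => ψ₂ (hτ.cocycle (ι x) w))
    ((hcont ψ₂).comp hF.continuous_map) (funext fun w => by
      rw [hF.map_pt, hτ.isFunctionCocycle_cocycle.map_one, map_one, Pi.one_apply])).unique
    ⟨⟨hcont ψ₁, hcoc ψ₁⟩, fun x => funext fun w => hψ ⟨_, hτ.cocycle_mem_schreierSet x w⟩⟩
    ⟨⟨hcont ψ₂, hcoc ψ₂⟩, fun x => rfl⟩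
  ext h
  have hh : hτ.cocycle h (((abstractFreeMap pt ι 1)⁻¹ : F) : F ⧸ H) = h :=
    hτ.cocycle_apply_mk_inv hT.one_mem hT.one_mem h h (by simp)
  rw [← hh]
  exact congrFun (congrFun heq h) _

end

theorem mainTheorem4 (𝒞 : ∀ (G : Type u) [Group G], Prop) (h𝒞 : IsExtensionClosedVariety 𝒞)
    {X : Type u} [TopologicalSpace X] (pt : X)
    {F : Type u} [Group F] [TopologicalSpace F] (ι : X → F) (hF : IsFreeProC 𝒞 pt ι)
    (H : Subgroup F) (hH : IsOpen (H : Set F)) :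
    (∃ (Y : Type u) (_ : TopologicalSpace Y) (y₀ : Y) (κ : Y → H), IsFreeProC 𝒞 y₀ κ) ∧
    (∃ T : Set (FreeGroup {x : X // x ≠ pt}),
      IsSchreierTransversal (H.comap (abstractFreeMap pt ι)) T) ∧
    (∀ T : Set (FreeGroup {x : X // x ≠ pt}),
      IsSchreierTransversal (H.comap (abstractFreeMap pt ι)) T →
      (∀ g : F, ∃! t, t ∈ T ∧ g * (abstractFreeMap pt ι t)⁻¹ ∈ H) ∧
      IsClosed (schreierSet pt ι H T) ∧
      ∃ h₁ : (1 : H) ∈ schreierSet pt ι H T,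
        IsFreeProC 𝒞 (⟨1, h₁⟩ : schreierSet pt ι H T)
          (fun b : schreierSet pt ι H T => (b : H))) := by
  have hmain : ∀ T : Set (FreeGroup {x : X // x ≠ pt}),
      IsSchreierTransversal (H.comap (abstractFreeMap pt ι)) T →
      (∀ g : F, ∃! t, t ∈ T ∧ g * (abstractFreeMap pt ι t)⁻¹ ∈ H) ∧
      IsClosed (schreierSet pt ι H T) ∧
      ∃ h₁ : (1 : H) ∈ schreierSet pt ι H T,
        IsFreeProC 𝒞 (⟨1, h₁⟩ : schreierSet pt ι H T)
          (fun b : schreierSet pt ι H T => (b : H)) := by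
    intro T hT
    have h𝒞' := h𝒞.toIsVarietyOfFiniteGroups
    have := hF.isProC.toIsTopologicalGroup
    have := hF.isProC.toCompactSpace
    have := hF.isProC.toT2Space
    have := hF.profinite_space.toCompactSpace
    have hHC : IsProC 𝒞 H := hF.isProC.of_isOpen h𝒞' H hH
    have := hHC.toCompactSpace
    have := hHC.toT2Space
    have := hHC.toTotallyDisconnectedSpace
    have : Finite (F ⧸ H) := Subgroup.quotient_finite_of_isOpen H hH
    have hrep := hF.existsUnique_mem_transversal h𝒞' hH hT
    obtain ⟨τ, hτ⟩ := exists_isCosetSection hrep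
    have hTfin : T.Finite := (Set.finite_range τ).subset fun t ht => ⟨_, hτ.apply_mk_inv t ht⟩
    have hcl : IsClosed (schreierSet pt ι H T) := isClosed_schreierSet hF.continuous_map hTfin
    have h₁ : (1 : H) ∈ schreierSet pt ι H T := one_mem_schreierSet hT.one_mem hF.map_pt
    refine ⟨hrep, hcl, h₁, ⟨isCompact_iff_compactSpace.1 hcl.isCompact, inferInstance,
      inferInstance⟩, hHC, continuous_subtype_val, rfl, fun G _ _ hG σ hσ hσ1 => ?_⟩
    obtain ⟨ψ, hψ⟩ := hF.exists_schreierSet_lift h𝒞 hH hT h₁ hG σ hσ hσ1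
    exact ⟨ψ, hψ, fun ψ' hψ' => hF.schreierSet_hom_ext h𝒞 hH hT hG fun b =>
      (hψ' b).trans (hψ b).symm⟩
  obtain ⟨T, hT⟩ := exists_isSchreierTransversal (H.comap (abstractFreeMap pt ι))
  obtain ⟨-, -, h₁, hfree⟩ := hmain T hT
  exact ⟨⟨_, _, _, _, hfree⟩, ⟨T, hT⟩, hmain⟩
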